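/- Let $(\Omega,\mathcal F,\mathbb P)$ be a probability space and let $X=(X(t))_{t\in\mathbb R}$ be a real-valued, jointly measurable process with stationary increments, i.e. for every $j\in\mathbb R$ the process $\delta_jX(t)=X(t)-X(t-2^j)$ is stationary. Let $\psi:\mathbb R\to\mathbb C$ be a wavelet: $\int(1+|t|)\,|\psi(t)|\,dt<\infty$ and $\int\psi(t)\,dt=0$. Assume that $\psi$ has only positive frequencies: $\widehat\psi(\omega)=\int\psi(t)e^{-i\omega t}\,dt=0$ for $\omega<0$. For $j\in\mathbb Z$ put $\psi_j(t)=2^{-j}\psi(2^{-j}t)$ and $WX(t,j)=X\star\psi_j(t)=\int X(u)\,\psi_j(t-u)\,du$. Let $\rho(z)=(z,|z|)$ for $z\in\mathbb C$, and for random vectors $A,B$ with values in $\mathbb C^2$ let $\mathrm{Cov}\{A,B\}$ be the $2\times2$ matrix with entries $\mathbb E\{A_pB_q^*\}-\mathbb E\{A_p\}\,\mathbb E\{B_q\}^*$. Let $j,a\in\mathbb Z$ be such that $\widehat\psi_j(\omega)\,\widehat\psi_{j-a}(\omega)=0$ for all $\omega\in\mathbb R$. If $X$ is a Gaussian process, then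 for all $t\in\mathbb R$ and $k\in\mathbb Z$ the integral defining $WX(t,k)$ converges absolutely almost surely and $WX(t,k)$ has a finite second moment, and for all $t,\tau\in\mathbb R$ $$\mathrm{Cov}\{\rho WX(t,j),\ \rho WX(t-2^j\tau,\,j-a)\}=0 .$$ Consequently, if some entry of this covariance matrix is non-zero for some $t,\tau\in\mathbb R$, then $X$ is not Gaussian. -/

import Mathlib

open MeasureTheory ProbabilityTheory
open scoped ComplexConjugate

noncomputable section

namespace WaveletCov

/-- The Fourier transform `f̂(ω) = ∫ f(t) e^{-iωt} dt` (angular frequency). -/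
def hat (f : ℝ → ℂ) (ω : ℝ) : ℂ :=
  ∫ t : ℝ, f t * Complex.exp (-Complex.I * (ω : ℂ) * (t : ℂ))

/-- A wavelet: a function with zero average that decays fast enough for `(1 + |t|) ψ(t)` to be
integrable. This is the decay under which the wavelet transform of a process with stationary
increments, which may grow linearly, is defined. -/
structure IsWavelet (ψ : ℝ → ℂ) : Prop where
  decay : Integrable (fun t : ℝ => ((1 + |t| : ℝ) : ℂ) * ψ t)
  zero_average : ∫ t : ℝ, ψ t = 0

/-- The wavelet only has positive frequencies: `ψ̂(ω) = 0` for `ω < 0`. -/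
def PositiveFrequencies (ψ : ℝ → ℂ) : Prop :=
  ∀ ω : ℝ, ω < 0 → hat ψ ω = 0

/-- The dilated wavelet `ψ_j(t) = 2^{-j} ψ(2^{-j} t)`. -/
def dilate (ψ : ℝ → ℂ) (j : ℤ) (t : ℝ) : ℂ :=
  (((2 : ℝ) ^ (-j) : ℝ) : ℂ) * ψ ((2 : ℝ) ^ (-j) * t)

/-- The wavelet transform `W x(t, j) = x ⋆ ψ_j (t) = ∫ x(u) ψ_j(t - u) du` of a signal `x`. -/
def waveletTransform (ψ : ℝ → ℂ) (x : ℝ → ℝ) (t : ℝ) (j : ℤ) : ℂ :=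
  ∫ u : ℝ, (x u : ℂ) * dilate ψ j (t - u)

/-- `ρ(z) = (z, |z|)`. -/
def rho (z : ℂ) : Fin 2 → ℂ := ![z, (‖z‖ : ℂ)]

section Defs

variable {Ω : Type*} [MeasurableSpace Ω]

/-- The increments `δ_j X(t) = X(t) - X(t - 2^j)`, for real `j`. -/
def increment (X : ℝ → Ω → ℝ) (j : ℝ) (t : ℝ) (ω : Ω) : ℝ :=
  X t ω - X (t - (2 : ℝ) ^ j) ω

/-- (Strict) stationarity: all finite-dimensional laws are invariant under time shifts. -/
def IsStationary (Y : ℝ → Ω → ℝ) (P : Measure Ω) : Prop :=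
  ∀ (h : ℝ) (I : Finset ℝ),
    P.map (fun ω => I.restrict (fun t => Y (t + h) ω)) =
      P.map (fun ω => I.restrict (fun t => Y t ω))

/-- `X` has stationary increments: `δ_j X` is stationary for every real `j`. -/
def HasStationaryIncrements (X : ℝ → Ω → ℝ) (P : Measure Ω) : Prop :=
  ∀ j : ℝ, IsStationary (increment X j) P

/-- The random vector `ρ W X(t, j)`. -/
def rhoW (ψ : ℝ → ℂ) (X : ℝ → Ω → ℝ) (t : ℝ) (j : ℤ) (ω : Ω) : Fin 2 → ℂ :=
  rho (waveletTransform ψ (fun u => X u ω) t j)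

/-- The covariance `Cov{A, B} = E{A B^*} - E{A} E{B}^*` of two random vectors with values in `ℂ²`,
a `2 × 2` matrix. -/
def covMatrix (P : Measure Ω) (A B : Ω → Fin 2 → ℂ) : Matrix (Fin 2) (Fin 2) ℂ :=
  Matrix.of fun p q =>
    (∫ ω, A ω p * conj (B ω q) ∂P) - (∫ ω, A ω p ∂P) * conj (∫ ω, B ω q ∂P)

end Defs

end WaveletCov

end

namespace WaveletCov

open Filter Topology Set
open scoped ENNReal Pointwise FourierTransform

/-! For Gaussian `X` the two wavelet coefficients A and B are independent, so every pair of
functions of them, the modulus included, is uncorrelated. Since A and B are jointly Gaussian complex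
variables, independence amounts to the vanishing of both the covariance E[A B*] - E[A] E[B]* and the
pseudo-covariance E[A B] - E[A] E[B].

Wavelets have zero mean, so X may be replaced by Y(u) = X(u) - X(0). Stationary increments give
Cov(Y(u), Y(v)) = (γ(u) + γ(v) - γ(u - v)) / 2 with γ(u) = Var Y(u) (`covariance_started`). Against
zero-mean functions only γ(u - v) contributes, and it pairs opposite frequencies: disjoint spectra
cancel the covariance, one-sided spectra cancel the pseudo-covariance
(`hat_clm_mul_hat_clm_eq_zero`).

No spectral measure is used. Since γ is unbounded, it is truncated to min(γ, N), where Fubini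
applies, and the limit is taken by dominated convergence (`IsVariogram.abs_kernel_le`). No
continuity of X is used either: joint measurability gives linear growth in mean square
(`exists_linear_growth`), and L² duality gives Gaussianity of the integrals
(`hasGaussianLaw_pathIntegral_real`). -/

/-! ### Linear growth of measurable subadditive functions. -/

/-- A measurable subadditive even function on the line grows at most linearly. -/
theorem exists_linear_growth {q : ℝ → ℝ} (hq : Measurable q)
    (hsub : ∀ x y, q (x - y) ≤ q x + q y) : ∃ C, 0 ≤ C ∧ ∀ x, q x ≤ C * (1 + |x|) := by
  obtain ⟨n, hn⟩ : ∃ n : ℕ, 0 < volume {x | q x ≤ n} := by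
    by_contra! h
    have : volume (⋃ n : ℕ, {x | q x ≤ n}) = 0 := by
      rw [measure_iUnion_null_iff]
      exact fun n => le_antisymm (h n) zero_le
    have h2 : (⋃ n : ℕ, {x | q x ≤ n}) = univ := by
      ext x
      simpa using exists_nat_ge (q x)
    rw [h2] at this
    simp at this
  have hE : MeasurableSet {x | q x ≤ n} := measurableSet_le hq measurable_const
  -- Steinhaus: the difference set of a sublevel set of positive measure contains a neighbourhood of
  -- 0, and subadditivity bounds `q` by 2n there.
  have hnhds := Measure.sub_mem_nhds_zero_of_addHaar_pos volume _ hE hn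
  obtain ⟨ε, hε, hball⟩ := Metric.mem_nhds_iff.1 hnhds
  have hq0 : q 0 ≤ 2 * n := by
    obtain ⟨a, ha, b, hb, hab⟩ := hball (Metric.mem_ball_self hε)
    have := hsub a b
    simp only [mem_ofPred_eq] at ha hb
    rw [show a - b = 0 from hab] at this
    linarith
  have hsmall : ∀ x, |x| < ε → q x ≤ 2 * n := by
    intro x hx
    obtain ⟨a, ha, b, hb, hab⟩ := hball (show x ∈ Metric.ball 0 ε by simpa using hx)
    have := hsub a b
    simp only [mem_ofPred_eq] at ha hb
    rw [show a - b = x from hab] at this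
    linarith
  have hneg : ∀ x, q (-x) ≤ q x + 2 * n := fun x => by
    have := hsub 0 x
    rw [zero_sub] at this
    linarith
  have hmul : ∀ (k : ℕ) (x : ℝ), |x| < ε → q (k * x) ≤ (4 * n) * (k + 1) := by
    intro k x hx
    induction k with
    | zero => simp; linarith [Nat.cast_nonneg (α := ℝ) n]
    | succ k ih =>
      have h1 := hsub (k * x) (-x)
      have h2 := hsmall (-x) (by simpa using hx)
      rw [show (k : ℝ) * x - -x = ((k + 1 : ℕ) : ℝ) * x by push_cast; ring] at h1
      push_cast at h1 ⊢
      nlinarith [Nat.cast_nonneg (α := ℝ) n]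
  -- With k = ⌊|x|/ε⌋ + 1 the point x/k has modulus below ε, and k + 1 ≤ 2 + |x|/ε ≤ (2 + 1/ε)(1 +
  -- |x|).
  refine ⟨4 * n * (1 + 1 + 1 / ε), by positivity, fun x => ?_⟩
  set k : ℕ := ⌊|x| / ε⌋₊ + 1 with hk
  have hk1 : |x| / ε < k := by rw [hk]; push_cast; exact Nat.lt_floor_add_one _
  have hk2 : (k : ℝ) ≤ |x| / ε + 1 := by
    rw [hk]; push_cast
    have := Nat.floor_le (show 0 ≤ |x| / ε by positivity)
    linarith
  have hkpos : (0 : ℝ) < k := by rw [hk]; positivity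
  have := hmul k (x / k) (by
    rw [abs_div, abs_of_pos hkpos, div_lt_iff₀ hkpos]
    rwa [div_lt_iff₀ hε, mul_comm] at hk1)
  rw [mul_div_cancel₀ _ hkpos.ne'] at this
  refine this.trans ?_
  rw [mul_assoc (4 * (n : ℝ))]
  refine mul_le_mul_of_nonneg_left ?_ (by positivity)
  have : (1 + 1 + 1 / ε) * (1 + |x|) = 2 + |x| / ε + (2 * |x| + 1 / ε) := by ring
  rw [this]
  have : 0 ≤ 2 * |x| + 1 / ε := by positivity
  linarith

/-! ### Uniqueness of the Fourier transform and cross-correlations. -/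

theorem hat_eq_fourier (f : ℝ → ℂ) (ξ : ℝ) : 𝓕 f ξ = hat f (2 * Real.pi * ξ) := by
  rw [Real.fourier_eq', hat]
  congr with t
  simp only [smul_eq_mul, RCLike.inner_apply, conj_trivial]
  rw [mul_comm]
  congr 2
  push_cast
  ring

/-- An integrable function on the line is determined by its Fourier transform. -/
theorem ae_eq_zero_of_hat_eq_zero {f : ℝ → ℂ} (hf : Integrable f) (h : ∀ ω, hat f ω = 0) :
    f =ᵐ[volume] 0 := by
  have hF : 𝓕 f = 0 := by
    ext ξ
    rw [hat_eq_fourier, h]; rfl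
  refine ae_eq_zero_of_integral_contDiff_smul_eq_zero hf.locallyIntegrable fun g hg hgc => ?_
  have hg₁ : HasCompactSupport (Complex.ofRealCLM ∘ g) := hgc.comp_left rfl
  have hg₂ : ContDiff ℝ (⊤ : ℕ∞) (Complex.ofRealCLM ∘ g) := by fun_prop
  set G : SchwartzMap ℝ ℂ := hg₁.toSchwartzMap hg₂ with hG
  -- The test function is the Fourier transform of a Schwartz function; self-adjointness moves that
  -- transform onto `f`.
  have key := VectorFourier.integral_fourierIntegral_smul_eq_flip (μ := volume) (ν := volume)
    (L := innerₗ ℝ) (f := f) (g := (𝓕⁻ G : SchwartzMap ℝ ℂ)) Real.continuous_fourierChar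
    continuous_inner hf (SchwartzMap.integrable _)
  have h1 : VectorFourier.fourierIntegral Real.fourierChar volume (innerₗ ℝ) f = 𝓕 f := rfl
  have h2 : VectorFourier.fourierIntegral Real.fourierChar volume (innerₗ ℝ).flip
      (𝓕⁻ G : SchwartzMap ℝ ℂ) = G := by
    rw [flip_innerₗ]
    change 𝓕 ((𝓕⁻ G : SchwartzMap ℝ ℂ) : ℝ → ℂ) = G
    rw [← SchwartzMap.fourier_coe, FourierTransform.fourier_fourierInv_eq]
  rw [h1, h2, hF] at key
  simp only [Pi.zero_apply, zero_smul, integral_zero] at key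
  rw [key]
  congr with x
  simp [hG, mul_comm]

/-- The cross-correlation `w ↦ ∫ p(v + w) r(v) dv`. -/
noncomputable def crossCorr (p r : ℝ → ℂ) (w : ℝ) : ℂ := ∫ v, r v * p (v + w)

theorem integrable_crossCorr_integrand {p r : ℝ → ℂ} (hp : Integrable p) (hr : Integrable r) :
    Integrable (fun z : ℝ × ℝ => r z.1 * p (z.1 + z.2)) (volume.prod volume) :=
  (measurePreserving_prod_add (volume : Measure ℝ) (volume : Measure ℝ)).integrable_comp_of_integrable
    (hr.mul_prod hp)

/-- Boundedness of `b` is what allows Fubini for merely integrable `p` and `r`. It is applied to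
characters and to truncated variograms. -/
theorem integral_mul_crossCorr {p r b : ℝ → ℂ} (hp : Integrable p) (hr : Integrable r)
    (hb : Measurable b) {M : ℝ} (hM : ∀ x, ‖b x‖ ≤ M) :
    ∫ w, b w * crossCorr p r w = ∫ v, r v * ∫ u, b (u - v) * p u := by
  have hint : Integrable (fun z : ℝ × ℝ => b z.2 * (r z.1 * p (z.1 + z.2)))
      (volume.prod volume) :=
    (integrable_crossCorr_integrand hp hr).bdd_mul
      (hb.comp measurable_snd).aestronglyMeasurable (ae_of_all _ fun z => hM _)
  calc ∫ w, b w * crossCorr p r w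
      = ∫ w, ∫ v, b w * (r v * p (v + w)) := by
        simp_rw [crossCorr, integral_const_mul]
    _ = ∫ v, ∫ w, b w * (r v * p (v + w)) := (integral_integral_swap hint).symm
    _ = ∫ v, r v * ∫ u, b (u - v) * p u := by
        congr with v
        rw [← integral_const_mul, ← integral_sub_right_eq_self _ v]
        congr with u
        rw [add_sub_cancel]
        ring

/-- Testing the cross-correlation against a character factors its transform at ω into the product in
`h`; uniqueness concludes. -/
theorem crossCorr_ae_eq_zero {p r : ℝ → ℂ} (hp : Integrable p) (hr : Integrable r)
    (h : ∀ ω, hat p ω * hat r (-ω) = 0) : crossCorr p r =ᵐ[volume] 0 := by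
  refine ae_eq_zero_of_hat_eq_zero (integrable_crossCorr_integrand hp hr).integral_prod_right
    fun ω => ?_
  rw [← h ω]
  have := integral_mul_crossCorr hp hr (b := fun t => Complex.exp (-Complex.I * ω * t))
    (by fun_prop) (M := 1) (fun x => by simp [Complex.norm_exp])
  simp only [hat]
  simp_rw [mul_comm (crossCorr p r _)]
  rw [this, ← integral_const_mul]
  congr with v
  rw [mul_comm (∫ t, _), mul_assoc]
  congr 1
  rw [← integral_const_mul]
  congr with u
  rw [mul_left_comm, ← Complex.exp_add, mul_comm]
  congr 2
  push_cast
  ring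

/-- Bounded stationary kernels vanish on pairs whose spectra do not interact. -/
theorem integral_integral_sub_eq_zero {p r b : ℝ → ℂ} (hp : Integrable p) (hr : Integrable r)
    (h : ∀ ω, hat p ω * hat r (-ω) = 0)
    (hb : Measurable b) {M : ℝ} (hM : ∀ x, ‖b x‖ ≤ M) :
    ∫ v, r v * ∫ u, b (u - v) * p u = 0 := by
  rw [← integral_mul_crossCorr hp hr hb hM]
  refine integral_eq_zero_of_ae ?_
  filter_upwards [crossCorr_ae_eq_zero hp hr h] with w hw
  simp [hw]

/-! ### Weighted integrability and variogram kernels. -/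

/-- Integrability against the weight `1 + |u|`. -/
def HasFirstMoment {E : Type*} [NormedAddCommGroup E] [NormedSpace ℝ E] (f : ℝ → E) : Prop :=
  Integrable (fun u : ℝ => (1 + |u|) • f u)

section HasFirstMoment
variable {E F : Type*} [NormedAddCommGroup E] [NormedSpace ℝ E]
  [NormedAddCommGroup F] [NormedSpace ℝ F] {f : ℝ → E}

theorem HasFirstMoment.integrable (hf : HasFirstMoment f) : Integrable f := by
  have : f = fun u => (1 + |u|)⁻¹ • ((1 + |u|) • f u) := by
    ext u
    rw [smul_smul, inv_mul_cancel₀ (by positivity), one_smul]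
  rw [this]
  refine Integrable.bdd_smul (C := 1) hf ?_ (ae_of_all _ fun u => ?_)
  · exact Measurable.aestronglyMeasurable (by fun_prop)
  · rw [norm_inv, Real.norm_of_nonneg (by positivity)]
    exact inv_le_one_of_one_le₀ (by linarith [abs_nonneg u])

theorem HasFirstMoment.clm_comp (hf : HasFirstMoment f) (L : E →L[ℝ] F) :
    HasFirstMoment (fun u => L (f u)) := by
  simpa [HasFirstMoment] using L.integrable_comp hf

theorem HasFirstMoment.lintegral_lt_top (hf : HasFirstMoment f) :
    ∫⁻ u, ENNReal.ofReal (1 + |u|) * ‖f u‖ₑ < ⊤ := by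
  have := hf.hasFiniteIntegral
  rw [hasFiniteIntegral_iff_enorm] at this
  convert this using 3 with u
  rw [enorm_smul, Real.enorm_of_nonneg (by positivity)]

end HasFirstMoment

/-- A variogram with at most quadratic growth and the corresponding regularity. -/
structure IsVariogram (γ : ℝ → ℝ) (C : ℝ) : Prop where
  measurable : Measurable γ
  nonneg : ∀ u, 0 ≤ γ u
  even : ∀ u, γ (-u) = γ u
  le : ∀ u, γ u ≤ C * (1 + |u|) ^ 2
  sub_le : ∀ u v, |γ u - γ v| ≤ C * (1 + |u - v|) * (2 + |u| + |v|)

/-- Bounding the terms one by one gives quadratic growth, too much for functions with only a first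
moment. For |v| ≤ |u| the difference γ(u) - γ(u - v) is of size (1 + |v|)(1 + |u|) by `sub_le`.
Truncation is 1-Lipschitz, so the bound is uniform in `N`, as dominated convergence requires. -/
theorem IsVariogram.abs_kernel_le {γ : ℝ → ℝ} {C : ℝ} (hγ : IsVariogram γ C) (hC : 0 ≤ C) {N : ℝ}
    (hN : 0 ≤ N) (u v : ℝ) :
    |min (γ u) N + min (γ v) N - min (γ (u - v)) N| ≤ 4 * C * ((1 + |u|) * (1 + |v|)) := by
  wlog huv : |v| ≤ |u| generalizing u v with H
  · have := H v u (le_of_not_ge huv)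
    rwa [← neg_sub u v, hγ.even, add_comm (min (γ v) N), mul_comm (1 + |v|)] at this
  have h1 : |min (γ v) N| ≤ C * (1 + |v|) ^ 2 := by
    rw [abs_of_nonneg (le_min (hγ.nonneg v) hN)]
    exact (min_le_left _ _).trans (hγ.le v)
  have h2 : |min (γ u) N - min (γ (u - v)) N| ≤ C * (1 + |v|) * (2 + |u| + |u - v|) := by
    refine (abs_min_sub_min_le_max _ _ _ _).trans ?_
    rw [sub_self, abs_zero, max_eq_left (abs_nonneg _)]
    simpa using hγ.sub_le u (u - v)
  have h3 : |u - v| ≤ |u| + |v| := abs_sub _ _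
  have h4 : |min (γ u) N + min (γ v) N - min (γ (u - v)) N| ≤
      |min (γ v) N| + |min (γ u) N - min (γ (u - v)) N| := by
    rw [show min (γ u) N + min (γ v) N - min (γ (u - v)) N =
      min (γ v) N + (min (γ u) N - min (γ (u - v)) N) by ring]
    exact abs_add_le _ _
  have h5 : C * (1 + |v|) * (2 + |u| + |u - v|) ≤ C * (1 + |v|) * (3 * (1 + |u|)) :=
    mul_le_mul_of_nonneg_left (by linarith) (by positivity)
  have h6 : C * (1 + |v|) ^ 2 ≤ C * (1 + |v|) * (1 + |u|) := by
    rw [pow_two, ← mul_assoc]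
    exact mul_le_mul_of_nonneg_left (by linarith) (by positivity)
  linarith

/-- After truncation the three terms are separately integrable: the first two vanish because the
function of the other variable has zero mean, the third because the spectra do not interact. Without
truncation only the combination is known to be integrable. -/
theorem integral_prod_kernel_eq_zero {γ : ℝ → ℝ} {C : ℝ} (hγ : IsVariogram γ C) (hC : 0 ≤ C)
    {p r : ℝ → ℂ} (hp : HasFirstMoment p) (hr : HasFirstMoment r)
    (hp0 : ∫ u, p u = 0) (hr0 : ∫ v, r v = 0) (h : ∀ ω, hat p ω * hat r (-ω) = 0) :
    ∫ z : ℝ × ℝ, ((γ z.1 + γ z.2 - γ (z.1 - z.2) : ℝ) : ℂ) * (p z.1 * r z.2)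
      ∂(volume.prod volume) = 0 := by
  have hγm := hγ.measurable
  have hprod := hp.integrable.mul_prod hr.integrable
  have hbdd : ∀ (N : ℕ) (x : ℝ), ‖((min (γ x) N : ℝ) : ℂ)‖ ≤ N := fun N x => by
    rw [Complex.norm_real, Real.norm_of_nonneg (le_min (hγ.nonneg x) N.cast_nonneg)]
    exact min_le_right _ _
  have hi : ∀ (N : ℕ) (φ : ℝ × ℝ → ℝ), Measurable φ →
      Integrable (fun z : ℝ × ℝ => ((min (γ (φ z)) N : ℝ) : ℂ) * (p z.1 * r z.2))
        (volume.prod volume) := fun N φ hφ =>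
    hprod.bdd_mul (c := N) (Measurable.aestronglyMeasurable (by fun_prop))
      (ae_of_all _ fun z => hbdd N _)
  have hzero : ∀ N : ℕ, ∫ z : ℝ × ℝ,
      ((min (γ z.1) N + min (γ z.2) N - min (γ (z.1 - z.2)) N : ℝ) : ℂ) * (p z.1 * r z.2)
      ∂(volume.prod volume) = 0 := by
    intro N
    have e : ∀ z : ℝ × ℝ,
      ((min (γ z.1) N + min (γ z.2) N - min (γ (z.1 - z.2)) N : ℝ) : ℂ) * (p z.1 * r z.2) =
        ((min (γ z.1) N : ℝ) : ℂ) * (p z.1 * r z.2) + ((min (γ z.2) N : ℝ) : ℂ) * (p z.1 * r z.2)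
        - ((min (γ (z.1 - z.2)) N : ℝ) : ℂ) * (p z.1 * r z.2) := fun z => by
      rw [Complex.ofReal_sub, Complex.ofReal_add]; ring
    simp_rw [e]
    have i1 := hi N Prod.fst measurable_fst
    have i2 := hi N Prod.snd measurable_snd
    have i3 := hi N (fun z => z.1 - z.2) (by fun_prop)
    rw [integral_sub (i1.fun_add i2) i3, integral_add i1 i2]
    have e1 : ∫ z : ℝ × ℝ, ((min (γ z.1) N : ℝ) : ℂ) * (p z.1 * r z.2) ∂(volume.prod volume)
        = 0 := by
      simp_rw [← mul_assoc]
      rw [integral_prod_mul (fun u => ((min (γ u) N : ℝ) : ℂ) * p u) r, hr0, mul_zero]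
    have e2 : ∫ z : ℝ × ℝ, ((min (γ z.2) N : ℝ) : ℂ) * (p z.1 * r z.2) ∂(volume.prod volume)
        = 0 := by
      simp_rw [mul_left_comm _ (p _)]
      rw [integral_prod_mul p (fun u => ((min (γ u) N : ℝ) : ℂ) * r u), hp0, zero_mul]
    have e3 : ∫ z : ℝ × ℝ, ((min (γ (z.1 - z.2)) N : ℝ) : ℂ) * (p z.1 * r z.2)
        ∂(volume.prod volume) = 0 := by
      rw [integral_prod_symm _ i3,
        ← integral_integral_sub_eq_zero hp.integrable hr.integrable h
          (b := fun x => ((min (γ x) N : ℝ) : ℂ)) (by fun_prop) (hbdd N)]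
      congr with v
      rw [← integral_const_mul]
      congr with u
      ring
    rw [e1, e2, e3]; simp
  have hlim := tendsto_integral_of_dominated_convergence (μ := volume.prod volume)
    (F := fun (N : ℕ) (z : ℝ × ℝ) =>
      ((min (γ z.1) N + min (γ z.2) N - min (γ (z.1 - z.2)) N : ℝ) : ℂ) * (p z.1 * r z.2))
    (f := fun z => ((γ z.1 + γ z.2 - γ (z.1 - z.2) : ℝ) : ℂ) * (p z.1 * r z.2))
    (fun z => 4 * C * (‖(1 + |z.1|) • p z.1‖ * ‖(1 + |z.2|) • r z.2‖))
    (fun N => (Measurable.aestronglyMeasurable (by fun_prop)).mul hprod.aestronglyMeasurable)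
    ((Integrable.mul_prod (Integrable.norm hp) (Integrable.norm hr)).const_mul _)
    (fun N => ae_of_all _ fun z => by
      rw [norm_mul, Complex.norm_real, Real.norm_eq_abs, norm_smul, norm_smul, norm_mul,
        Real.norm_of_nonneg (show 0 ≤ 1 + |z.1| by positivity),
        Real.norm_of_nonneg (show 0 ≤ 1 + |z.2| by positivity)]
      refine (mul_le_mul_of_nonneg_right (hγ.abs_kernel_le hC N.cast_nonneg z.1 z.2)
        (by positivity)).trans_eq ?_
      ring)
    (ae_of_all _ fun z => by
      refine tendsto_const_nhds.congr' ?_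
      obtain ⟨n, hn⟩ := exists_nat_ge (max (γ z.1) (max (γ z.2) (γ (z.1 - z.2))))
      simp only [max_le_iff] at hn
      filter_upwards [eventually_ge_atTop n] with N hN
      have hN' : (n : ℝ) ≤ N := by exact_mod_cast hN
      rw [min_eq_left (hn.1.trans hN'), min_eq_left (hn.2.1.trans hN'),
        min_eq_left (hn.2.2.trans hN')])
  simp_rw [hzero] at hlim
  exact tendsto_nhds_unique hlim tendsto_const_nhds

theorem IsVariogram.integrable_kernel {γ : ℝ → ℝ} {C : ℝ} (hγ : IsVariogram γ C) (hC : 0 ≤ C)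
    {p r : ℝ → ℂ} (hp : HasFirstMoment p) (hr : HasFirstMoment r) :
    Integrable (fun z : ℝ × ℝ => ((γ z.1 + γ z.2 - γ (z.1 - z.2) : ℝ) : ℂ) * (p z.1 * r z.2))
      (volume.prod volume) := by
  have hγm := hγ.measurable
  refine ((Integrable.mul_prod (Integrable.norm hp) (Integrable.norm hr)).const_mul (4 * C)).mono'
    ((Measurable.aestronglyMeasurable (by fun_prop)).mul
      (hp.integrable.mul_prod hr.integrable).aestronglyMeasurable) (ae_of_all _ fun z => ?_)
  -- A level above all three values makes the truncation invisible.
  have h := hγ.abs_kernel_le hC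
    (N := max (γ z.1) (max (γ z.2) (γ (z.1 - z.2)))) (le_max_of_le_left (hγ.nonneg _)) z.1 z.2
  rw [min_eq_left (le_max_left _ _), min_eq_left ((le_max_left _ _).trans (le_max_right _ _)),
    min_eq_left ((le_max_right _ _).trans (le_max_right _ _))] at h
  rw [norm_mul, Complex.norm_real, Real.norm_eq_abs, norm_smul, norm_smul, norm_mul,
    Real.norm_of_nonneg (show 0 ≤ 1 + |z.1| by positivity),
    Real.norm_of_nonneg (show 0 ≤ 1 + |z.2| by positivity)]
  refine (mul_le_mul_of_nonneg_right h (by positivity)).trans_eq ?_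
  ring

/-- The covariance kernel of a process with stationary increments vanishes on pairs of functions
with zero average whose spectra do not interact. -/
theorem integral_integral_kernel_eq_zero {γ : ℝ → ℝ} {C : ℝ} (hγ : IsVariogram γ C) (hC : 0 ≤ C)
    {f g : ℝ → ℝ} (hf : HasFirstMoment f) (hg : HasFirstMoment g)
    (hf0 : ∫ u, f u = 0) (hg0 : ∫ v, g v = 0)
    (h : ∀ ω, hat (fun u => (f u : ℂ)) ω * hat (fun v => (g v : ℂ)) (-ω) = 0) :
    ∫ v, ∫ u, (γ u + γ v - γ (u - v)) * (f u * g v) = 0 := by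
  have hf' : HasFirstMoment (fun u => (f u : ℂ)) := hf.clm_comp Complex.ofRealCLM
  have hg' : HasFirstMoment (fun u => (g u : ℂ)) := hg.clm_comp Complex.ofRealCLM
  have key := integral_prod_kernel_eq_zero hγ hC hf' hg'
    (by rw [integral_complex_ofReal, hf0, Complex.ofReal_zero])
    (by rw [integral_complex_ofReal, hg0, Complex.ofReal_zero]) h
  rw [integral_prod_symm _ (hγ.integrable_kernel hC hf' hg')] at key
  rw [← Complex.ofReal_eq_zero, ← integral_complex_ofReal, ← key]
  congr with v
  rw [← integral_complex_ofReal]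
  congr with u
  push_cast
  ring

/-! ### Second-order theory of pathwise integrals. -/

/-- The pathwise integral `∫ X(u) f(u) du`. -/
noncomputable def pathIntegral {Ω E : Type*} [NormedAddCommGroup E] [NormedSpace ℝ E]
    (X : ℝ → Ω → ℝ) (f : ℝ → E) (ω : Ω) : E := ∫ u, X u ω • f u

section PathIntegral
variable {Ω E : Type*} [MeasurableSpace Ω] [NormedAddCommGroup E] [NormedSpace ℝ E]
  {P : Measure Ω} {X : ℝ → Ω → ℝ} {C : ℝ} {f : ℝ → E}

theorem lintegral_enorm_mul_enorm_le {Y Z : Ω → ℝ} (hY : AEStronglyMeasurable Y P)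
    (hZ : AEStronglyMeasurable Z P) :
    ∫⁻ ω, ‖Y ω‖ₑ * ‖Z ω‖ₑ ∂P ≤ eLpNorm Y 2 P * eLpNorm Z 2 P := by
  have := eLpNorm_smul_le_mul_eLpNorm (p := 2) (q := 2) (r := 1) hZ hY
  rw [eLpNorm_one_eq_lintegral_enorm] at this
  simpa [enorm_mul] using this

theorem aestronglyMeasurable_uncurry_smul [SFinite P] (hX : Measurable (Function.uncurry X))
    (hf : AEStronglyMeasurable f) :
    AEStronglyMeasurable (fun z : Ω × ℝ => X z.2 z.1 • f z.2) (P.prod volume) :=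
  (hX.comp measurable_swap).aestronglyMeasurable.smul hf.comp_snd

/-- Tonelli's theorem for the integral of the absolute values of a process. -/
theorem lintegral_mul_lintegral_enorm [SFinite P] (hX : Measurable (Function.uncurry X))
    (hf : AEStronglyMeasurable f) {T : Ω → ℝ≥0∞} (hT : AEMeasurable T P) :
    ∫⁻ ω, T ω * (∫⁻ u, ‖X u ω • f u‖ₑ) ∂P = ∫⁻ u, ‖f u‖ₑ * ∫⁻ ω, T ω * ‖X u ω‖ₑ ∂P := by
  have hXu : ∀ u, Measurable (X u) := fun u => hX.comp measurable_prodMk_left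
  have hm := aestronglyMeasurable_uncurry_smul (P := P) hX hf
  calc ∫⁻ ω, T ω * (∫⁻ u, ‖X u ω • f u‖ₑ) ∂P
      = ∫⁻ ω, (∫⁻ u, T ω * ‖X u ω • f u‖ₑ) ∂P := by
        refine lintegral_congr_ae ?_
        filter_upwards [hm.prodMk_left] with ω hω
        rw [lintegral_const_mul'' _ hω.enorm]
    _ = ∫⁻ u, ∫⁻ ω, T ω * ‖X u ω • f u‖ₑ ∂P :=
        lintegral_lintegral_swap (hT.comp_fst.mul hm.enorm)
    _ = ∫⁻ u, ‖f u‖ₑ * ∫⁻ ω, T ω * ‖X u ω‖ₑ ∂P := by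
        refine lintegral_congr fun u => ?_
        rw [← lintegral_const_mul' _ _ enorm_ne_top]
        refine lintegral_congr fun ω => ?_
        rw [enorm_smul]
        ring

/-- At most linear growth of a process in mean square. -/
def HasLinearGrowth (X : ℝ → Ω → ℝ) (P : Measure Ω) (C : ℝ) : Prop :=
  ∀ u, eLpNorm (X u) 2 P ≤ ENNReal.ofReal C * ENNReal.ofReal (1 + |u|)

theorem lintegral_enorm_mul_lintegral_lt_top [IsFiniteMeasure P]
    (hX : Measurable (Function.uncurry X)) (hg : HasLinearGrowth X P C)
    (hf : HasFirstMoment f) {Y : Ω → ℝ} (hY : MemLp Y 2 P) :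
    ∫⁻ ω, ‖Y ω‖ₑ * (∫⁻ u, ‖X u ω • f u‖ₑ) ∂P < ∞ := by
  have hXu : ∀ u, Measurable (X u) := fun u => hX.comp measurable_prodMk_left
  rw [lintegral_mul_lintegral_enorm hX hf.integrable.aestronglyMeasurable
    hY.aestronglyMeasurable.enorm]
  calc ∫⁻ u, ‖f u‖ₑ * ∫⁻ ω, ‖Y ω‖ₑ * ‖X u ω‖ₑ ∂P
      ≤ ∫⁻ u, (eLpNorm Y 2 P * ENNReal.ofReal C) * (ENNReal.ofReal (1 + |u|) * ‖f u‖ₑ) := by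
        refine lintegral_mono fun u => ?_
        have := lintegral_enorm_mul_enorm_le hY.aestronglyMeasurable
          (hXu u).aestronglyMeasurable (P := P)
        calc _ ≤ ‖f u‖ₑ * (eLpNorm Y 2 P * (ENNReal.ofReal C * ENNReal.ofReal (1 + |u|))) := by
              gcongr
              exact this.trans (by gcongr; exact hg u)
          _ = _ := by ring
    _ < ∞ := by
        rw [lintegral_const_mul' _ _ (ENNReal.mul_ne_top hY.eLpNorm_ne_top ENNReal.ofReal_ne_top)]
        exact ENNReal.mul_lt_top (ENNReal.mul_lt_top hY.eLpNorm_lt_top ENNReal.ofReal_lt_top)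
          hf.lintegral_lt_top

theorem integrable_mul_uncurry_smul [IsFiniteMeasure P]
    (hX : Measurable (Function.uncurry X)) (hg : HasLinearGrowth X P C)
    (hf : HasFirstMoment f) {Y : Ω → ℝ} (hY : MemLp Y 2 P) :
    Integrable (fun z : Ω × ℝ => Y z.1 • X z.2 z.1 • f z.2) (P.prod volume) := by
  have hm := aestronglyMeasurable_uncurry_smul (P := P) hX hf.integrable.aestronglyMeasurable
  have hm' : AEStronglyMeasurable (fun z : Ω × ℝ => Y z.1 • X z.2 z.1 • f z.2)
      (P.prod volume) := hY.aestronglyMeasurable.comp_fst.smul hm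
  refine ⟨hm', ?_⟩
  rw [hasFiniteIntegral_iff_enorm, lintegral_prod _ hm'.enorm]
  refine lt_of_eq_of_lt ?_ (lintegral_enorm_mul_lintegral_lt_top hX hg hf hY)
  refine lintegral_congr_ae ?_
  filter_upwards [hm.prodMk_left] with ω hω
  rw [← lintegral_const_mul'' _ hω.enorm]
  simp [enorm_smul]

theorem integrable_uncurry_smul [IsFiniteMeasure P]
    (hX : Measurable (Function.uncurry X)) (hg : HasLinearGrowth X P C) (hf : HasFirstMoment f) :
    Integrable (fun z : Ω × ℝ => X z.2 z.1 • f z.2) (P.prod volume) := by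
  simpa using integrable_mul_uncurry_smul hX hg hf (memLp_const (1 : ℝ))

theorem ae_integrable_smul [IsFiniteMeasure P]
    (hX : Measurable (Function.uncurry X)) (hg : HasLinearGrowth X P C) (hf : HasFirstMoment f) :
    ∀ᵐ ω ∂P, Integrable (fun u => X u ω • f u) :=
  (integrable_uncurry_smul hX hg hf).prod_right_ae

/-- An integral Minkowski inequality: two uses of Tonelli expand E[S²] into a double integral of
E|X(u) X(v)|, and Cauchy–Schwarz with linear growth bounds it by a product of first moments. -/
theorem memLp_pathIntegral [IsFiniteMeasure P]
    (hX : Measurable (Function.uncurry X)) (hg : HasLinearGrowth X P C) (hf : HasFirstMoment f) :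
    MemLp (pathIntegral X f) 2 P := by
  have hXu : ∀ u, Measurable (X u) := fun u => hX.comp measurable_prodMk_left
  have hfm := hf.integrable.aestronglyMeasurable
  have hm := aestronglyMeasurable_uncurry_smul (P := P) hX hfm
  refine ⟨hm.integral_prod_right', ?_⟩
  set S : Ω → ℝ≥0∞ := fun ω => ∫⁻ u, ‖X u ω • f u‖ₑ with hS
  have hSm : AEMeasurable S P := hm.enorm.lintegral_prod_right'
  have key : ∫⁻ ω, S ω * S ω ∂P < ∞ := by
    rw [lintegral_mul_lintegral_enorm hX hfm hSm]
    have h1 : ∀ u, ∫⁻ ω, S ω * ‖X u ω‖ₑ ∂P ≤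
        ENNReal.ofReal (1 + |u|) * (ENNReal.ofReal C * (ENNReal.ofReal C *
          ∫⁻ v, ENNReal.ofReal (1 + |v|) * ‖f v‖ₑ)) := by
      intro u
      simp_rw [mul_comm (S _)]
      rw [lintegral_mul_lintegral_enorm hX hfm (hXu u).aemeasurable.enorm,
        ← lintegral_const_mul' _ _ ENNReal.ofReal_ne_top,
        ← lintegral_const_mul' _ _ ENNReal.ofReal_ne_top,
        ← lintegral_const_mul' _ _ ENNReal.ofReal_ne_top]
      refine lintegral_mono fun v => ?_
      calc ‖f v‖ₑ * ∫⁻ ω, ‖X u ω‖ₑ * ‖X v ω‖ₑ ∂P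
          ≤ ‖f v‖ₑ * ((ENNReal.ofReal C * ENNReal.ofReal (1 + |u|)) *
              (ENNReal.ofReal C * ENNReal.ofReal (1 + |v|))) := by
            gcongr
            exact (lintegral_enorm_mul_enorm_le (hXu u).aestronglyMeasurable
              (hXu v).aestronglyMeasurable).trans (mul_le_mul' (hg u) (hg v))
        _ = _ := by ring
    set D := ENNReal.ofReal C * (ENNReal.ofReal C * ∫⁻ v, ENNReal.ofReal (1 + |v|) * ‖f v‖ₑ)
    have hD : D < ∞ := ENNReal.mul_lt_top ENNReal.ofReal_lt_top
      (ENNReal.mul_lt_top ENNReal.ofReal_lt_top hf.lintegral_lt_top)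
    calc ∫⁻ u, ‖f u‖ₑ * ∫⁻ ω, S ω * ‖X u ω‖ₑ ∂P
        ≤ ∫⁻ u, D * (ENNReal.ofReal (1 + |u|) * ‖f u‖ₑ) := by
          refine lintegral_mono fun u => ?_
          calc _ ≤ ‖f u‖ₑ * (ENNReal.ofReal (1 + |u|) * D) := by gcongr; exact h1 u
            _ = _ := by ring
      _ = D * ∫⁻ u, ENNReal.ofReal (1 + |u|) * ‖f u‖ₑ := lintegral_const_mul' _ _ hD.ne
      _ < ∞ := ENNReal.mul_lt_top hD hf.lintegral_lt_top
  rw [eLpNorm_lt_top_iff_lintegral_rpow_enorm_lt_top (by norm_num) (by norm_num)]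
  refine lt_of_le_of_lt (lintegral_mono fun ω => ?_) key
  have : ‖pathIntegral X f ω‖ₑ ≤ S ω := enorm_integral_le_lintegral_enorm _
  simpa [pow_two] using mul_le_mul' this this

variable [CompleteSpace E]

/-- Pairing with an arbitrary L² variable commutes with the pathwise integral. Both the covariance
formula and the orthogonality argument for Gaussianity rest on this. -/
theorem integral_smul_pathIntegral [IsFiniteMeasure P]
    (hX : Measurable (Function.uncurry X)) (hg : HasLinearGrowth X P C)
    (hf : HasFirstMoment f) {Y : Ω → ℝ} (hY : MemLp Y 2 P) :
    ∫ ω, Y ω • pathIntegral X f ω ∂P = ∫ u, (∫ ω, Y ω * X u ω ∂P) • f u := by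
  simp_rw [pathIntegral, ← integral_smul]
  rw [integral_integral_swap (integrable_mul_uncurry_smul hX hg hf hY)]
  simp_rw [smul_smul, integral_smul_const]

theorem clm_comp_pathIntegral_ae_eq [IsFiniteMeasure P] {F : Type*} [NormedAddCommGroup F]
    [NormedSpace ℝ F] [CompleteSpace F] (hX : Measurable (Function.uncurry X))
    (hg : HasLinearGrowth X P C) (hf : HasFirstMoment f) (L : E →L[ℝ] F) :
    L ∘ pathIntegral X f =ᵐ[P] pathIntegral X (fun u => L (f u)) := by
  filter_upwards [ae_integrable_smul hX hg hf] with ω hω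
  simp only [pathIntegral, Function.comp_apply]
  rw [← L.integral_comp_comm hω]
  simp_rw [map_smul]

theorem HasLinearGrowth.memLp (hX : Measurable (Function.uncurry X))
    (hg : HasLinearGrowth X P C) (u : ℝ) : MemLp (X u) 2 P :=
  ⟨(hX.comp measurable_prodMk_left).aestronglyMeasurable, (hg u).trans_lt
    (ENNReal.mul_lt_top ENNReal.ofReal_lt_top ENNReal.ofReal_lt_top)⟩

theorem covariance_pathIntegral_right [IsProbabilityMeasure P]
    (hX : Measurable (Function.uncurry X)) (hg : HasLinearGrowth X P C)
    {f : ℝ → ℝ} (hf : HasFirstMoment f) {Y : Ω → ℝ} (hY : MemLp Y 2 P) :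
    cov[Y, pathIntegral X f; P] = ∫ u, cov[Y, X u; P] * f u := by
  -- Centring one factor is enough to turn the pairing into a covariance.
  have h1 := integral_smul_pathIntegral hX hg hf (hY.sub (memLp_const (∫ ω, Y ω ∂P)))
  have hI := memLp_pathIntegral hX hg hf
  have e : ∀ Z : Ω → ℝ, MemLp Z 2 P → ∫ ω, (Y - fun _ => ∫ ω, Y ω ∂P : Ω → ℝ) ω * Z ω ∂P = cov[Y, Z; P] := by
    intro Z hZ
    rw [covariance_eq_sub hY hZ, ← integral_const_mul, ← integral_sub]
    · simp [sub_mul]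
    · exact hY.integrable_mul hZ
    · exact (hZ.integrable (by norm_num)).const_mul _
  simp_rw [e _ (hg.memLp hX _), smul_eq_mul] at h1
  rw [← h1, e _ hI]

theorem covariance_pathIntegral_pathIntegral [IsProbabilityMeasure P]
    (hX : Measurable (Function.uncurry X)) (hg : HasLinearGrowth X P C)
    {f g : ℝ → ℝ} (hf : HasFirstMoment f) (hg' : HasFirstMoment g) :
    cov[pathIntegral X f, pathIntegral X g; P] = ∫ v, ∫ u, cov[X u, X v; P] * (f u * g v) := by
  rw [covariance_pathIntegral_right hX hg hg' (memLp_pathIntegral hX hg hf)]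
  congr with v
  rw [covariance_comm, covariance_pathIntegral_right hX hg hf (hg.memLp hX v),
    ← integral_mul_const]
  congr with u
  rw [covariance_comm]
  ring

end PathIntegral

/-! ### Gaussianity of pathwise integrals through L² closure. -/

section Closure
variable {Ω : Type*} [MeasurableSpace Ω] {P : Measure Ω}

theorem charFun_map_Lp (Z : Lp ℝ 2 P) (t : ℝ) :
    charFun (P.map Z) t = ∫ ω, Complex.exp ((t * Z ω : ℝ) * Complex.I) ∂P := by
  rw [charFun_apply_real, integral_map (Lp.aestronglyMeasurable Z).aemeasurable
    (Continuous.aestronglyMeasurable (by fun_prop))]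
  simp

/-- Linear combinations of a square-integrable Gaussian process are Gaussian. -/
theorem hasGaussianLaw_of_mem_span {X : ℝ → Ω → ℝ} (hG : IsGaussianProcess X P)
    (hm : ∀ u, MemLp (X u) 2 P) {Z : Lp ℝ 2 P}
    (hZ : Z ∈ Submodule.span ℝ (range fun u => (hm u).toLp (X u))) : HasGaussianLaw Z P := by
  obtain ⟨c, rfl⟩ := Finsupp.mem_span_range_iff_exists_finsupp.1 hZ
  have h := (hG.smul c).hasGaussianLaw_sum (I := c.support)
  refine h.congr ?_
  rw [Finsupp.sum]
  refine EventuallyEq.trans ?_ (Lp.coeFn_finsetSum _ _).symm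
  have hall : ∀ᵐ ω ∂P, ∀ u ∈ c.support,
      (c u • (hm u).toLp (X u) : Lp ℝ 2 P) ω = c u • X u ω := by
    rw [Finset.eventually_all]
    intro u _
    filter_upwards [Lp.coeFn_smul (c u) ((hm u).toLp (X u)), (hm u).coeFn_toLp] with ω h1 h2
    rw [h1, Pi.smul_apply, h2]
  filter_upwards [hall] with ω hω
  rw [Finset.sum_apply, Finset.sum_apply]
  exact Finset.sum_congr rfl fun u hu => (hω u hu).symm

variable [IsProbabilityMeasure P]

theorem integral_norm_le_norm_Lp (Z : Lp ℝ 2 P) : ∫ ω, ‖Z ω‖ ∂P ≤ ‖Z‖ := by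
  rw [integral_norm_eq_lintegral_enorm (Lp.aestronglyMeasurable Z), Lp.norm_def,
    ← eLpNorm_one_eq_lintegral_enorm]
  exact ENNReal.toReal_mono (Lp.eLpNorm_ne_top Z)
    (eLpNorm_le_eLpNorm_of_exponent_le (by norm_num) (Lp.aestronglyMeasurable Z))

theorem integrable_Lp_two (Z : Lp ℝ 2 P) : Integrable Z P :=
  (Lp.memLp Z).integrable (by norm_num)

theorem norm_integral_comp_sub_le {F : Type*} [NormedAddCommGroup F] [NormedSpace ℝ F]
    {g : ℝ → F} {K : ℝ} (hK : ∀ x y, ‖g x - g y‖ ≤ K * ‖x - y‖) (hK0 : 0 ≤ K)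
    (hg : ∀ Z : Lp ℝ 2 P, Integrable (fun ω => g (Z ω)) P) (Z W : Lp ℝ 2 P) :
    ‖∫ ω, g (Z ω) ∂P - ∫ ω, g (W ω) ∂P‖ ≤ K * ‖Z - W‖ := by
  rw [← integral_sub (hg Z) (hg W)]
  refine (norm_integral_le_of_norm_le
    (((integrable_Lp_two (Z - W)).norm).const_mul K) ?_).trans ?_
  · filter_upwards [Lp.coeFn_sub Z W] with ω hω
    rw [hω]
    exact hK _ _
  · rw [integral_const_mul]
    exact mul_le_mul_of_nonneg_left (integral_norm_le_norm_Lp _) hK0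

theorem continuous_integral_comp {F : Type*} [NormedAddCommGroup F] [NormedSpace ℝ F]
    {g : ℝ → F} {K : ℝ} (hK : ∀ x y, ‖g x - g y‖ ≤ K * ‖x - y‖) (hK0 : 0 ≤ K)
    (hg : ∀ Z : Lp ℝ 2 P, Integrable (fun ω => g (Z ω)) P) :
    Continuous (fun Z : Lp ℝ 2 P => ∫ ω, g (Z ω) ∂P) := by
  refine (LipschitzWith.of_dist_le_mul (K := K.toNNReal) fun Z W => ?_).continuous
  rw [dist_eq_norm, dist_eq_norm, Real.coe_toNNReal _ hK0]
  exact norm_integral_comp_sub_le hK hK0 hg Z W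

theorem norm_exp_mul_I_sub_le (x y : ℝ) :
    ‖Complex.exp (x * Complex.I) - Complex.exp (y * Complex.I)‖ ≤ ‖x - y‖ := by
  have : Complex.exp (x * Complex.I) - Complex.exp (y * Complex.I) =
      Complex.exp (y * Complex.I) * (Complex.exp (Complex.I * (x - y : ℝ)) - 1) := by
    rw [mul_sub, ← Complex.exp_add, mul_one]
    congr 2
    push_cast
    ring
  rw [this, norm_mul, Complex.norm_exp_ofReal_mul_I, one_mul]
  exact Real.norm_exp_I_mul_ofReal_sub_one_le

/-- The square-integrable Gaussian random variables form a closed set. -/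
theorem isClosed_hasGaussianLaw : IsClosed {Z : Lp ℝ 2 P | HasGaussianLaw Z P} := by
  -- Gaussianity is one characteristic-function identity for each t. With the variance written as
  -- ‖Z‖² minus the squared mean, both sides are continuous in Z for the L² norm.
  have hset : {Z : Lp ℝ 2 P | HasGaussianLaw Z P} = ⋂ t : ℝ, {Z : Lp ℝ 2 P |
      ∫ ω, Complex.exp ((t * Z ω : ℝ) * Complex.I) ∂P =
        Complex.exp (((∫ ω, t * Z ω ∂P : ℝ) : ℂ) * Complex.I -
          ((t ^ 2 * (‖Z‖ ^ 2 - (∫ ω, Z ω ∂P) ^ 2) : ℝ) : ℂ) / 2)} := by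
    ext Z
    have hvar : Var[Z; P] = ‖Z‖ ^ 2 - (∫ ω, Z ω ∂P) ^ 2 := by
      rw [variance_eq_sub (Lp.memLp Z), ← real_inner_self_eq_norm_sq, L2.inner_def]
      simp [pow_two]
    simp only [mem_ofPred_eq, mem_iInter]
    rw [hasGaussianLaw_iff_charFun_map_eq (Lp.aestronglyMeasurable Z).aemeasurable]
    refine forall_congr' fun t => ?_
    rw [charFun_map_Lp, ← hvar, ← variance_const_mul]
    simp [mul_comm]
  rw [hset]
  refine isClosed_iInter fun t => isClosed_eq ?_ ?_
  · refine continuous_integral_comp (g := fun x => Complex.exp ((t * x : ℝ) * Complex.I))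
      (K := |t|) (fun x y => ?_) (abs_nonneg t) fun Z => ?_
    · refine (norm_exp_mul_I_sub_le _ _).trans_eq ?_
      rw [← mul_sub, norm_mul, Real.norm_eq_abs t]
    · refine Integrable.of_bound (C := 1) ?_ (ae_of_all _ fun ω => ?_)
      · exact (show Continuous fun x : ℝ => Complex.exp ((t * x : ℝ) * Complex.I) by
          fun_prop).comp_aestronglyMeasurable (Lp.aestronglyMeasurable Z)
      · rw [Complex.norm_exp_ofReal_mul_I]
  · have hmean : Continuous (fun Z : Lp ℝ 2 P => ∫ ω, Z ω ∂P) :=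
      continuous_integral_comp (g := id) (K := 1) (fun x y => by simp) zero_le_one
        integrable_Lp_two
    simp_rw [integral_const_mul]
    fun_prop

variable {X : ℝ → Ω → ℝ} {C : ℝ}

/-- A variable orthogonal to every `X u` is orthogonal to the integral, so the integral lies in the
double orthogonal complement of their span, that is, in its closure. Limits of Gaussian variables in
L² are Gaussian; no Riemann sums are needed. -/
theorem hasGaussianLaw_pathIntegral_real (hG : IsGaussianProcess X P)
    (hX : Measurable (Function.uncurry X)) (hg : HasLinearGrowth X P C)
    {f : ℝ → ℝ} (hf : HasFirstMoment f) : HasGaussianLaw (pathIntegral X f) P := by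
  have hm := hg.memLp hX
  have hI := memLp_pathIntegral hX hg hf
  set S := Submodule.span ℝ (range fun u => (hm u).toLp (X u)) with hS
  have hmem : hI.toLp _ ∈ S.topologicalClosure := by
    rw [← Submodule.orthogonal_orthogonal_eq_closure, Submodule.mem_orthogonal]
    intro Y hY
    rw [Submodule.mem_orthogonal'] at hY
    have h1 : ∀ (Z : Ω → ℝ) (hZ : MemLp Z 2 P), inner ℝ Y (hZ.toLp Z) = ∫ ω, Y ω * Z ω ∂P := by
      intro Z hZ
      rw [L2.inner_def]
      refine integral_congr_ae ?_
      filter_upwards [hZ.coeFn_toLp] with ω hω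
      rw [hω]
      simp [mul_comm]
    have h2 : ∀ u, ∫ ω, Y ω * X u ω ∂P = 0 := fun u => by
      rw [← h1 _ (hm u)]
      exact hY _ (Submodule.subset_span (mem_range_self u))
    have h3 := integral_smul_pathIntegral hX hg hf (Lp.memLp Y)
    simp only [h2, zero_smul, integral_zero] at h3
    rw [h1]
    exact h3
  have hcl : closure (S : Set (Lp ℝ 2 P)) ⊆ {Z : Lp ℝ 2 P | HasGaussianLaw Z P} :=
    closure_minimal (fun Z hZ => hasGaussianLaw_of_mem_span hG hm hZ) isClosed_hasGaussianLaw
  exact HasGaussianLaw.congr (hcl hmem) hI.coeFn_toLp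

/-- The integrals of a Gaussian process against vector-valued functions are Gaussian. -/
theorem hasGaussianLaw_pathIntegral {E : Type*} [NormedAddCommGroup E] [NormedSpace ℝ E]
    [CompleteSpace E] [MeasurableSpace E] [BorelSpace E]
    (hG : IsGaussianProcess X P) (hX : Measurable (Function.uncurry X))
    (hg : HasLinearGrowth X P C) {f : ℝ → E} (hf : HasFirstMoment f) :
    HasGaussianLaw (pathIntegral X f) P := by
  have hI := (memLp_pathIntegral hX hg hf).aestronglyMeasurable.aemeasurable
  refine ⟨isGaussian_of_isGaussian_map fun L => ?_⟩
  rw [AEMeasurable.map_map_of_aemeasurable (by fun_prop) hI]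
  refine (HasGaussianLaw.congr
    (hasGaussianLaw_pathIntegral_real hG hX hg (hf.clm_comp L))
    (clm_comp_pathIntegral_ae_eq hX hg hf L).symm).isGaussian_map

end Closure

/-! ### Subtracting the value at time zero. -/

section Started
variable {Ω : Type*} {X : ℝ → Ω → ℝ}

/-- The process started at zero. -/
def started (X : ℝ → Ω → ℝ) (u : ℝ) (ω : Ω) : ℝ := X u ω - X 0 ω

theorem started_sub_started (u v : ℝ) :
    started X u - started X v = fun ω => X u ω - X v ω := by
  ext ω
  simp [started]

theorem pathIntegral_started {E : Type*} [NormedAddCommGroup E] [NormedSpace ℝ E]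
    {f : ℝ → E} (hf : Integrable f) (h0 : ∫ u, f u = 0) :
    pathIntegral (started X) f = pathIntegral X f := by
  ext ω
  have e : (fun u => started X u ω • f u) = (fun u => X u ω • f u) - fun u => X 0 ω • f u := by
    ext u
    simp [started, sub_smul]
  have hc : Integrable (fun u => X 0 ω • f u) := hf.smul (X 0 ω)
  by_cases hi : Integrable (fun u => X u ω • f u)
  · simp only [pathIntegral]
    rw [e, integral_sub' hi hc, integral_smul, h0, smul_zero, sub_zero]
  -- The two integrands differ by an integrable function, so neither is integrable here and both
  -- integrals take the default value 0. The identity thus holds for every ω, not just almost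
  -- surely.
  · simp only [pathIntegral]
    rw [integral_undef hi, integral_undef]
    rw [e]
    intro h
    apply hi
    simpa using h.add hc

end Started

/-! ### Growth and covariance structure of stationary increments. -/

section Increments
variable {Ω : Type*} [MeasurableSpace Ω] {P : Measure Ω} {X : ℝ → Ω → ℝ}

/-- Since the scale is a real number, log₂(u - v) reaches every positive lag. Stationarity is then
needed only at the single time u - v, with shift v. -/
theorem HasStationaryIncrements.identDistrib_of_lt (hstat : HasStationaryIncrements X P)
    (hX : ∀ u, Measurable (X u)) {u v : ℝ} (huv : v < u) :
    IdentDistrib (fun ω => X u ω - X v ω) (fun ω => X (u - v) ω - X 0 ω) P P := by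
  refine ⟨((hX u).sub (hX v)).aemeasurable, ((hX _).sub (hX 0)).aemeasurable, ?_⟩
  have hpos : 0 < u - v := sub_pos.2 huv
  have h2 : (2 : ℝ) ^ Real.logb 2 (u - v) = u - v :=
    Real.rpow_logb (by norm_num) (by norm_num) hpos
  have hinc : ∀ t, Measurable (increment X (Real.logb 2 (u - v)) t) := fun t =>
    (hX _).sub (hX _)
  have h := hstat (Real.logb 2 (u - v)) v {u - v}
  have hm : Measurable (fun x : ({u - v} : Finset ℝ) → ℝ => x ⟨u - v, by simp⟩) :=
    measurable_pi_apply _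
  have h' := congrArg (fun μ => μ.map (fun x : ({u - v} : Finset ℝ) → ℝ => x ⟨u - v, by simp⟩)) h
  have hr : ∀ c, Measurable fun ω => ({u - v} : Finset ℝ).restrict
      fun t => increment X (Real.logb 2 (u - v)) (t + c) ω :=
    fun c => measurable_pi_lambda _ fun i => hinc _
  have hr0 := hr 0
  simp only [add_zero] at hr0
  rw [Measure.map_map hm (hr v), Measure.map_map hm hr0] at h'
  convert h' using 2
  · ext ω
    simp [increment, h2]
  · ext ω
    simp [increment, h2]

theorem HasStationaryIncrements.identDistrib (hstat : HasStationaryIncrements X P)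
    (hX : ∀ u, Measurable (X u)) (u v : ℝ) :
    IdentDistrib (fun ω => X u ω - X v ω) (fun ω => X (u - v) ω - X 0 ω) P P := by
  rcases lt_trichotomy v u with h | h | h
  · exact hstat.identDistrib_of_lt hX h
  · subst h
    simpa using IdentDistrib.refl (μ := P) (aemeasurable_const (b := (0 : ℝ)))
  -- For a negative lag, both sides are distributed as the negative of X(v - u) - X(0).
  · have h1 := (hstat.identDistrib_of_lt hX h).comp measurable_neg
    have h2 := (hstat.identDistrib_of_lt hX (sub_neg.2 h)).comp measurable_neg
    simp only [zero_sub, neg_sub] at h2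
    convert h1.trans h2.symm using 1 <;> (ext ω; simp)

theorem measurable_uncurry_started (hX : Measurable (Function.uncurry X)) :
    Measurable (Function.uncurry (started X)) :=
  hX.sub (hX.comp (measurable_const.prodMk measurable_snd))

theorem isGaussianProcess_started (hG : IsGaussianProcess X P) :
    IsGaussianProcess (started X) P := by
  have h := hG.shift 0
  simp only [zero_add] at h
  exact h

theorem covariance_congr_ae {A A' B B' : Ω → ℝ} (hA : A =ᵐ[P] A') (hB : B =ᵐ[P] B') :
    cov[A, B; P] = cov[A', B'; P] := by
  simp only [covariance, integral_congr_ae hA, integral_congr_ae hB]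
  refine integral_congr_ae ?_
  filter_upwards [hA, hB] with ω h1 h2
  rw [h1, h2]

/-- The mean-square norm. -/
noncomputable def rms (P : Measure Ω) (Y : Ω → ℝ) : ℝ := (eLpNorm Y 2 P).toReal

theorem rms_nonneg (Y : Ω → ℝ) : 0 ≤ rms P Y := ENNReal.toReal_nonneg

theorem rms_sub_le {Y Z : Ω → ℝ} (hY : MemLp Y 2 P) (hZ : MemLp Z 2 P) :
    rms P (Y - Z) ≤ rms P Y + rms P Z := by
  rw [rms, rms, rms, ← ENNReal.toReal_add hY.eLpNorm_ne_top hZ.eLpNorm_ne_top]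
  exact ENNReal.toReal_mono (ENNReal.add_ne_top.2 ⟨hY.eLpNorm_ne_top, hZ.eLpNorm_ne_top⟩)
    (eLpNorm_sub_le hY.aestronglyMeasurable hZ.aestronglyMeasurable (by norm_num))

theorem rms_add_le {Y Z : Ω → ℝ} (hY : MemLp Y 2 P) (hZ : MemLp Z 2 P) :
    rms P (Y + Z) ≤ rms P Y + rms P Z := by
  rw [rms, rms, rms, ← ENNReal.toReal_add hY.eLpNorm_ne_top hZ.eLpNorm_ne_top]
  exact ENNReal.toReal_mono (ENNReal.add_ne_top.2 ⟨hY.eLpNorm_ne_top, hZ.eLpNorm_ne_top⟩)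
    (eLpNorm_add_le hY.aestronglyMeasurable hZ.aestronglyMeasurable (by norm_num))

theorem abs_integral_mul_le_rms {Y Z : Ω → ℝ} (hY : MemLp Y 2 P) (hZ : MemLp Z 2 P) :
    |∫ ω, Y ω * Z ω ∂P| ≤ rms P Y * rms P Z := by
  have h := lintegral_enorm_mul_enorm_le hY.aestronglyMeasurable hZ.aestronglyMeasurable
  rw [rms, rms, ← ENNReal.toReal_mul, ← Real.norm_eq_abs]
  refine (norm_integral_le_integral_norm _).trans ?_
  rw [integral_norm_eq_lintegral_enorm (hY.aestronglyMeasurable.fun_mul hZ.aestronglyMeasurable)]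
  simp_rw [enorm_mul]
  exact ENNReal.toReal_mono (ENNReal.mul_ne_top hY.eLpNorm_ne_top hZ.eLpNorm_ne_top) h

variable [IsProbabilityMeasure P]

theorem abs_integral_le_rms {Y : Ω → ℝ} (hY : MemLp Y 2 P) : |∫ ω, Y ω ∂P| ≤ rms P Y := by
  have h := abs_integral_mul_le_rms hY (memLp_const (1 : ℝ))
  have h1 : rms P (fun _ => (1 : ℝ)) = 1 := by
    rw [rms, eLpNorm_const _ (by norm_num) (IsProbabilityMeasure.ne_zero P)]
    simp
  simpa [h1] using h

theorem abs_covariance_le_rms {Y Z : Ω → ℝ} (hY : MemLp Y 2 P) (hZ : MemLp Z 2 P) :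
    |cov[Y, Z; P]| ≤ 2 * (rms P Y * rms P Z) := by
  rw [covariance_eq_sub hY hZ]
  refine (abs_sub _ _).trans ?_
  have h1 := abs_integral_mul_le_rms hY hZ
  have h2 : |(∫ ω, Y ω ∂P) * ∫ ω, Z ω ∂P| ≤ rms P Y * rms P Z := by
    rw [abs_mul]
    exact mul_le_mul (abs_integral_le_rms hY) (abs_integral_le_rms hZ) (abs_nonneg _)
      (rms_nonneg _)
  simp only [Pi.mul_apply]
  linarith

theorem measurable_rms_process {Y : ℝ → Ω → ℝ} (hY : Measurable (Function.uncurry Y)) :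
    Measurable (fun u => rms P (Y u)) := by
  simp only [rms, eLpNorm_eq_lintegral_rpow_enorm_toReal (show (2 : ℝ≥0∞) ≠ 0 by norm_num)
    (show (2 : ℝ≥0∞) ≠ ∞ by norm_num)]
  have h : Measurable (fun u => ∫⁻ ω, ‖Y u ω‖ₑ ^ (2 : ℝ≥0∞).toReal ∂P) :=
    Measurable.lintegral_prod_right' (f := fun z : ℝ × Ω => ‖Y z.1 z.2‖ₑ ^ (2 : ℝ≥0∞).toReal)
      (hY.enorm.pow_const _)
  exact (h.pow_const _).ennreal_toReal

theorem measurable_variance_process {Y : ℝ → Ω → ℝ} (hY : Measurable (Function.uncurry Y))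
    (hm : ∀ u, MemLp (Y u) 2 P) : Measurable (fun u => Var[Y u; P]) := by
  simp_rw [variance_eq_sub (hm _)]
  have h1 : Measurable (fun u => ∫ ω, Y u ω ∂P) :=
    (StronglyMeasurable.integral_prod_right (f := Y) hY.stronglyMeasurable).measurable
  have h2 : Measurable (fun u => ∫ ω, (Y u ^ 2) ω ∂P) :=
    (StronglyMeasurable.integral_prod_right (f := fun u => Y u ^ 2)
      (hY.pow_const 2).stronglyMeasurable).measurable
  exact h2.sub (h1.pow_const 2)

/-- Square-integrable measurable processes with stationary increments grow at most linearly, and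
their variogram has the corresponding regularity. -/
theorem exists_growth_variogram (hX : Measurable (Function.uncurry X))
    (hstat : HasStationaryIncrements X P) (hm : ∀ u, MemLp (X u) 2 P) :
    ∃ C, 0 ≤ C ∧ HasLinearGrowth (started X) P C ∧
      IsVariogram (fun u => Var[started X u; P]) (2 * C ^ 2) := by
  have hXu : ∀ u, Measurable (X u) := fun u => hX.comp measurable_prodMk_left
  have hY := measurable_uncurry_started hX
  have hYm : ∀ u, MemLp (started X u) 2 P := fun u => (hm u).sub (hm 0)
  have hid := hstat.identDistrib hXu
  have hrms : ∀ u v, rms P (started X u - started X v) = rms P (started X (u - v)) := by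
    intro u v
    rw [started_sub_started, rms, (hid u v).eLpNorm_eq]
    rfl
  -- The mean-square size of an increment depends only on its lag, so the triangle inequality in L²
  -- makes it subadditive.
  obtain ⟨C, hC, hbd⟩ := exists_linear_growth (measurable_rms_process (P := P) hY)
    (fun x y => by rw [← hrms]; exact rms_sub_le (hYm x) (hYm y))
  refine ⟨C, hC, fun u => ?_, ?_⟩
  · rw [← ENNReal.ofReal_mul hC, ← ENNReal.ofReal_toReal (hYm u).eLpNorm_ne_top]
    exact ENNReal.ofReal_le_ofReal (hbd u)
  refine ⟨measurable_variance_process hY hYm, fun u => variance_nonneg _ _, fun u => ?_,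
    fun u => ?_, fun u v => ?_⟩
  · have h := (hid 0 u).variance_eq
    rw [zero_sub] at h
    change Var[fun ω => X (-u) ω - X 0 ω; P] = Var[fun ω => X u ω - X 0 ω; P]
    rw [← h, ← variance_fun_neg]
    simp
  · have h := abs_covariance_le_rms (hYm u) (hYm u)
    rw [covariance_self (hYm u).aestronglyMeasurable.aemeasurable] at h
    have h2 := hbd u
    calc Var[started X u; P] ≤ 2 * (rms P (started X u) * rms P (started X u)) :=
          (le_abs_self _).trans h
      _ ≤ 2 * ((C * (1 + |u|)) * (C * (1 + |u|))) := by
          have := rms_nonneg (P := P) (started X u)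
          gcongr
      _ = _ := by ring
  -- The identity Var A - Var B = Cov(A - B, A + B) gives a factor linear in the lag; the two linear
  -- bounds and the factor 2 of `abs_covariance_le_rms` produce 2C².
  · have hd : Var[started X u; P] - Var[started X v; P] =
        cov[started X u - started X v, started X u + started X v; P] := by
      rw [covariance_sub_left (hYm u) (hYm v) ((hYm u).add (hYm v)),
        covariance_add_right (hYm u) (hYm u) (hYm v), covariance_add_right (hYm v) (hYm u) (hYm v),
        covariance_self (hYm u).aestronglyMeasurable.aemeasurable,
        covariance_self (hYm v).aestronglyMeasurable.aemeasurable,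
        covariance_comm (started X v) (started X u)]
      ring
    rw [hd]
    refine (abs_covariance_le_rms ((hYm u).sub (hYm v)) ((hYm u).add (hYm v))).trans ?_
    rw [hrms]
    have h1 := hbd (u - v)
    have h2 : rms P (started X u + started X v) ≤ C * (2 + |u| + |v|) := by
      refine (rms_add_le (hYm u) (hYm v)).trans ?_
      linarith [hbd u, hbd v]
    calc 2 * (rms P (started X (u - v)) * rms P (started X u + started X v))
        ≤ 2 * ((C * (1 + |u - v|)) * (C * (2 + |u| + |v|))) := by
          have := rms_nonneg (P := P) (started X (u - v))
          have := rms_nonneg (P := P) (started X u + started X v)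
          gcongr
      _ = _ := by ring

/-- Polarisation: the variance of Y(u) - Y(v) is that of Y(u - v), with Y the started process. -/
theorem covariance_started (hX : ∀ u, Measurable (X u))
    (hstat : HasStationaryIncrements X P) (hm : ∀ u, MemLp (X u) 2 P) (u v : ℝ) :
    cov[started X u, started X v; P] =
      2⁻¹ * (Var[started X u; P] + Var[started X v; P] - Var[started X (u - v); P]) := by
  have hYm : ∀ u, MemLp (started X u) 2 P := fun u => (hm u).sub (hm 0)
  have h := variance_sub (hYm u) (hYm v)
  rw [started_sub_started, (hstat.identDistrib hX u v).variance_eq] at h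
  change Var[started X (u - v); P] = _ at h
  rw [h]
  ring

/-- Integrals against functions of zero average with non-interacting spectra are uncorrelated. -/
theorem covariance_pathIntegral_eq_zero (hX : Measurable (Function.uncurry X))
    (hstat : HasStationaryIncrements X P) (hm : ∀ u, MemLp (X u) 2 P)
    {f g : ℝ → ℝ} (hf : HasFirstMoment f) (hg : HasFirstMoment g)
    (hf0 : ∫ u, f u = 0) (hg0 : ∫ v, g v = 0)
    (h : ∀ ω, hat (fun u => (f u : ℂ)) ω * hat (fun v => (g v : ℂ)) (-ω) = 0) :
    cov[pathIntegral (started X) f, pathIntegral (started X) g; P] = 0 := by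
  have hXu : ∀ u, Measurable (X u) := fun u => hX.comp measurable_prodMk_left
  obtain ⟨C, hC, hgr, hv⟩ := exists_growth_variogram hX hstat hm
  rw [covariance_pathIntegral_pathIntegral (measurable_uncurry_started hX) hgr hf hg]
  simp_rw [covariance_started hXu hstat hm, mul_assoc (2⁻¹ : ℝ), integral_const_mul]
  rw [integral_integral_kernel_eq_zero hv (by positivity) hf hg hf0 hg0 h, mul_zero]

end Increments

/-! ### Spectra of real-linear images of complex functions. -/

section Fourier
variable {f g : ℝ → ℂ}

theorem integrable_mul_exp (hf : Integrable f) (ω : ℝ) :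
    Integrable (fun t : ℝ => f t * Complex.exp (-Complex.I * ω * t)) := by
  refine hf.mul_bdd (c := 1) (Continuous.aestronglyMeasurable (by fun_prop))
    (ae_of_all _ fun t => ?_)
  simp [Complex.norm_exp]

theorem hat_conj (f : ℝ → ℂ) (ω : ℝ) : hat (fun t => conj (f t)) ω = conj (hat f (-ω)) := by
  rw [hat, hat, ← integral_conj]
  congr with t
  rw [map_mul, ← Complex.exp_conj]
  simp

theorem hat_zero (f : ℝ → ℂ) : hat f 0 = ∫ t, f t := by simp [hat]

/-- Real-linear functionals mix z and its conjugate; hence the spectrum of a real projection mixes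
the frequencies ω and -ω. -/
theorem ofReal_clm_apply (L : ℂ →L[ℝ] ℝ) (z : ℂ) :
    ((L z : ℝ) : ℂ) = ((L 1 - Complex.I * L Complex.I) / 2) * z +
      ((L 1 + Complex.I * L Complex.I) / 2) * conj z := by
  have h : L z = z.re * L 1 + z.im * L Complex.I := by
    conv_lhs => rw [← Complex.re_add_im z, ← mul_one (z.re : ℂ), ← Complex.real_smul,
      ← Complex.real_smul, map_add, map_smul, map_smul]
    simp
  rw [h]
  apply Complex.ext <;> simp <;> ring

theorem hat_clm (L : ℂ →L[ℝ] ℝ) (hf : Integrable f) (ω : ℝ) :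
    hat (fun t => ((L (f t) : ℝ) : ℂ)) ω = ((L 1 - Complex.I * L Complex.I) / 2) * hat f ω +
      ((L 1 + Complex.I * L Complex.I) / 2) * conj (hat f (-ω)) := by
  rw [← hat_conj]
  simp only [hat]
  have hc : Integrable (fun t => conj (f t)) :=
    (Complex.conjCLE : ℂ →L[ℝ] ℂ).integrable_comp hf
  rw [← integral_const_mul, ← integral_const_mul, ← integral_add
    ((integrable_mul_exp hf ω).const_mul _) ((integrable_mul_exp hc ω).const_mul _)]
  congr with t
  rw [ofReal_clm_apply]
  ring

/-- The product expands into four terms. The two containing exactly one conjugate are covariance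
terms and vanish by `h1`; the other two are pseudo-covariance terms and vanish by `h2`. -/
theorem hat_clm_mul_hat_clm_eq_zero (L M : ℂ →L[ℝ] ℝ) (hf : Integrable f) (hg : Integrable g)
    (h1 : ∀ ω, hat f ω * hat g ω = 0) (h2 : ∀ ω, hat f ω * hat g (-ω) = 0) (ω : ℝ) :
    hat (fun t => ((L (f t) : ℝ) : ℂ)) ω * hat (fun t => ((M (g t) : ℝ) : ℂ)) (-ω) = 0 := by
  rw [hat_clm L hf, hat_clm M hg, neg_neg]
  have a1 := h2 ω
  have a2 : hat f ω * conj (hat g ω) = 0 := by simpa using h1 ω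
  have a3 : conj (hat f (-ω)) * hat g (-ω) = 0 := by simpa using h1 (-ω)
  have a4 : conj (hat f (-ω)) * conj (hat g ω) = 0 := by
    rw [← map_mul, show hat f (-ω) * hat g ω = 0 by simpa using h2 (-ω), map_zero]
  linear_combination
    ((L 1 - Complex.I * L Complex.I) / 2) * ((M 1 - Complex.I * M Complex.I) / 2) * a1 +
    ((L 1 - Complex.I * L Complex.I) / 2) * ((M 1 + Complex.I * M Complex.I) / 2) * a2 +
    ((L 1 + Complex.I * L Complex.I) / 2) * ((M 1 - Complex.I * M Complex.I) / 2) * a3 +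
    ((L 1 + Complex.I * L Complex.I) / 2) * ((M 1 + Complex.I * M Complex.I) / 2) * a4

end Fourier

/-! ### Wavelet atoms and their spectra. -/

section Atoms
variable {ψ : ℝ → ℂ}

/-- The time-reversed, dilated and translated wavelet `u ↦ ψ_k(t - u)`. -/
noncomputable def atom (ψ : ℝ → ℂ) (t : ℝ) (k : ℤ) (u : ℝ) : ℂ := dilate ψ k (t - u)

theorem IsWavelet.hasFirstMoment_atom (hψ : IsWavelet ψ) (t : ℝ) (k : ℤ) :
    HasFirstMoment (atom ψ t k) := by
  set c : ℝ := (2 : ℝ) ^ (-k) with hc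
  have hc0 : 0 < c := by positivity
  have h1 : Integrable (fun u : ℝ => ((1 + |c * (t - u)| : ℝ) : ℂ) * ψ (c * (t - u))) :=
    (hψ.decay.comp_mul_left' hc0.ne').comp_sub_left t
  have h2 : (fun u => (1 + |u|) • atom ψ t k u) = (fun u => c * (1 + |u|) / (1 + |c * (t - u)|)) •
      (fun u : ℝ => ((1 + |c * (t - u)| : ℝ) : ℂ) * ψ (c * (t - u))) := by
    ext u
    have hne : (1 + |c * (t - u)| : ℝ) ≠ 0 := by positivity
    simp only [atom, dilate, Pi.smul_apply', Complex.real_smul, ← hc]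
    rw [← mul_assoc, ← mul_assoc, ← Complex.ofReal_mul, ← Complex.ofReal_mul,
      div_mul_cancel₀ _ hne, mul_comm (1 + |u|)]
  rw [HasFirstMoment, h2]
  -- The constant bounds the ratio of weights: c(1 + |u|) ≤ c(1 + |t|) + c|t - u| by the triangle
  -- inequality.
  refine h1.bdd_smul (c * (1 + |t|) + 1) (Measurable.aestronglyMeasurable (by fun_prop))
    (ae_of_all _ fun u => ?_)
  rw [Real.norm_of_nonneg (by positivity), div_le_iff₀ (by positivity)]
  have h3 : |u| ≤ |t| + |t - u| := by
    have := abs_sub t (t - u)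
    rwa [sub_sub_cancel] at this
  rw [abs_mul, abs_of_pos hc0]
  have h4 : c * |u| ≤ c * (|t| + |t - u|) := mul_le_mul_of_nonneg_left h3 hc0.le
  have h5 : 0 ≤ c * (1 + |t|) * (c * |t - u|) := by positivity
  nlinarith

theorem integral_dilate (ψ : ℝ → ℂ) (k : ℤ) : ∫ t, dilate ψ k t = ∫ t, ψ t := by
  have hc0 : (0 : ℝ) < (2 : ℝ) ^ (-k) := by positivity
  simp only [dilate]
  rw [integral_const_mul, Measure.integral_comp_mul_left, abs_of_pos (inv_pos.2 hc0),
    Complex.real_smul, ← mul_assoc, ← Complex.ofReal_mul, mul_inv_cancel₀ hc0.ne']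
  simp

theorem IsWavelet.integral_atom (hψ : IsWavelet ψ) (t : ℝ) (k : ℤ) : ∫ u, atom ψ t k u = 0 := by
  simp only [atom]
  rw [integral_sub_left_eq_self (dilate ψ k) volume t, integral_dilate, hψ.zero_average]

theorem hat_dilate (ψ : ℝ → ℂ) (k : ℤ) (ω : ℝ) :
    hat (dilate ψ k) ω = hat ψ ((2 : ℝ) ^ k * ω) := by
  have e : (fun t : ℝ => dilate ψ k t * Complex.exp (-Complex.I * ω * t)) =
      dilate (fun t => ψ t * Complex.exp (-Complex.I * ((2 : ℝ) ^ k * ω : ℝ) * t)) k := by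
    ext t
    simp only [dilate]
    rw [← mul_assoc]
    congr 2
    have : ((2 : ℝ) ^ k * ω) * ((2 : ℝ) ^ (-k) * t) = ω * t := by
      rw [zpow_neg]
      field_simp
    rw [mul_assoc, mul_assoc, ← Complex.ofReal_mul, ← Complex.ofReal_mul, this]
  rw [hat, e, integral_dilate]
  rfl

theorem hat_atom (ψ : ℝ → ℂ) (t : ℝ) (k : ℤ) (ω : ℝ) :
    hat (atom ψ t k) ω = Complex.exp (-Complex.I * ω * t) * hat (dilate ψ k) (-ω) := by
  simp only [hat]
  rw [← integral_const_mul, ← integral_sub_left_eq_self _ volume t]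
  congr with u
  simp only [atom, sub_sub_cancel]
  rw [mul_left_comm, ← Complex.exp_add]
  congr 2
  push_cast
  ring

theorem hat_atom_mul_hat_atom {j k : ℤ}
    (hdisj : ∀ ω : ℝ, hat (dilate ψ j) ω * hat (dilate ψ k) ω = 0) (s t ω : ℝ) :
    hat (atom ψ t j) ω * hat (atom ψ s k) ω = 0 := by
  rw [hat_atom, hat_atom, mul_mul_mul_comm, hdisj, mul_zero]

/-- Both atoms are time-reversed, so their spectra lie in the negative half-line, which cannot
contain both ω and -ω. -/
theorem hat_atom_mul_hat_atom_neg (hψ : IsWavelet ψ) (hpos : PositiveFrequencies ψ) (j k : ℤ)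
    (s t ω : ℝ) : hat (atom ψ t j) ω * hat (atom ψ s k) (-ω) = 0 := by
  have hneg : ∀ (k : ℤ) {ω : ℝ}, ω ≤ 0 → hat (dilate ψ k) ω = 0 := by
    intro k ω hω
    rw [hat_dilate]
    rcases hω.lt_or_eq with h | h
    · exact hpos _ (mul_neg_of_pos_of_neg (by positivity) h)
    -- Frequency 0 is not covered by `hpos`; it is excluded by the zero average.
    · rw [h, mul_zero, hat_zero, hψ.zero_average]
  rw [hat_atom, hat_atom, mul_mul_mul_comm, neg_neg]
  rcases le_total ω 0 with h | h
  · rw [hneg k h, mul_zero, mul_zero]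
  · rw [hneg j (neg_nonpos.2 h), zero_mul, mul_zero]

theorem waveletTransform_eq_pathIntegral {Ω : Type*} (ψ : ℝ → ℂ) (X : ℝ → Ω → ℝ) (t : ℝ) (k : ℤ)
    (ω : Ω) :
    waveletTransform ψ (fun u => X u ω) t k = pathIntegral X (atom ψ t k) ω := by
  simp [waveletTransform, pathIntegral, atom]

theorem IsWavelet.waveletTransform_eq {Ω : Type*} {X : ℝ → Ω → ℝ} (hψ : IsWavelet ψ) (t : ℝ) (k : ℤ) (ω : Ω) :
    waveletTransform ψ (fun u => X u ω) t k = pathIntegral (started X) (atom ψ t k) ω := by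
  rw [waveletTransform_eq_pathIntegral, pathIntegral_started
    (hψ.hasFirstMoment_atom t k).integrable (hψ.integral_atom t k)]

end Atoms

/-! ### Independence of the coefficients and the covariance matrix. -/

section Gaussian
variable {Ω : Type*} [MeasurableSpace Ω] {P : Measure Ω} [IsProbabilityMeasure P]
  {X : ℝ → Ω → ℝ} {ψ : ℝ → ℂ}

theorem measurable_rho (p : Fin 2) : Measurable (fun z => rho z p) := by
  fin_cases p <;> simp only [rho] <;> simp <;> fun_prop

/-- Wavelet coefficients of a Gaussian process with stationary increments are independent when the
spectra of the wavelets are disjoint. -/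
theorem indepFun_pathIntegral_atom (hX : Measurable (Function.uncurry X))
    (hstat : HasStationaryIncrements X P) (hG : IsGaussianProcess X P)
    (hψ : IsWavelet ψ) (hpos : PositiveFrequencies ψ) {j k : ℤ}
    (hdisj : ∀ ω : ℝ, hat (dilate ψ j) ω * hat (dilate ψ k) ω = 0) (t s : ℝ) :
    IndepFun (pathIntegral (started X) (atom ψ t j)) (pathIntegral (started X) (atom ψ s k)) P := by
  have hm : ∀ u, MemLp (X u) 2 P := fun u => (hG.hasGaussianLaw_eval u).memLp_two
  obtain ⟨C, hC, hgr, -⟩ := exists_growth_variogram hX hstat hm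
  have hY := measurable_uncurry_started hX
  have hf := hψ.hasFirstMoment_atom t j
  have hg := hψ.hasFirstMoment_atom s k
  -- Treating the two atoms as one ℂ × ℂ-valued function yields joint Gaussianity, not just
  -- Gaussianity of each coefficient.
  have hfg : HasFirstMoment (fun u => (atom ψ t j u, atom ψ s k u)) := Integrable.prodMk hf hg
  have hlaw : HasGaussianLaw (fun ω => (pathIntegral (started X) (atom ψ t j) ω,
      pathIntegral (started X) (atom ψ s k) ω)) P := by
    refine (hasGaussianLaw_pathIntegral (isGaussianProcess_started hG) hY hgr hfg).congr ?_
    filter_upwards [ae_integrable_smul hY hgr hf, ae_integrable_smul hY hgr hg] with ω h1 h2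
    exact integral_pair h1 h2
  -- Testing all real functionals of the complex coefficients covers covariance and
  -- pseudo-covariance together.
  refine hlaw.indepFun_of_covariance_strongDual fun L M => ?_
  rw [covariance_congr_ae (clm_comp_pathIntegral_ae_eq hY hgr hf L)
    (clm_comp_pathIntegral_ae_eq hY hgr hg M)]
  refine covariance_pathIntegral_eq_zero hX hstat hm (hf.clm_comp L) (hg.clm_comp M) ?_ ?_
    (hat_clm_mul_hat_clm_eq_zero L M hf.integrable hg.integrable
      (hat_atom_mul_hat_atom hdisj s t) (hat_atom_mul_hat_atom_neg hψ hpos j k s t))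
  · rw [L.integral_comp_comm hf.integrable, hψ.integral_atom, map_zero]
  · rw [M.integral_comp_comm hg.integrable, hψ.integral_atom, map_zero]

theorem ae_integrable_waveletTransform (hX : Measurable (Function.uncurry X))
    (hstat : HasStationaryIncrements X P) (hG : IsGaussianProcess X P) (hψ : IsWavelet ψ)
    (t : ℝ) (k : ℤ) : ∀ᵐ ω ∂P, Integrable (fun u : ℝ => (X u ω : ℂ) * dilate ψ k (t - u)) := by
  have hm : ∀ u, MemLp (X u) 2 P := fun u => (hG.hasGaussianLaw_eval u).memLp_two
  obtain ⟨C, hC, hgr, -⟩ := exists_growth_variogram hX hstat hm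
  have hf := hψ.hasFirstMoment_atom t k
  filter_upwards [ae_integrable_smul (measurable_uncurry_started hX) hgr hf] with ω hω
  have h := hω.add (hf.integrable.smul (X 0 ω))
  refine h.congr (ae_of_all _ fun u => ?_)
  simp only [Pi.add_apply, Pi.smul_apply, started, Complex.real_smul, atom]
  push_cast
  ring

theorem memLp_rhoW (hX : Measurable (Function.uncurry X))
    (hstat : HasStationaryIncrements X P) (hG : IsGaussianProcess X P) (hψ : IsWavelet ψ)
    (t : ℝ) (k : ℤ) (p : Fin 2) : MemLp (fun ω => rhoW ψ X t k ω p) 2 P := by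
  have hm : ∀ u, MemLp (X u) 2 P := fun u => (hG.hasGaussianLaw_eval u).memLp_two
  obtain ⟨C, hC, hgr, -⟩ := exists_growth_variogram hX hstat hm
  have h := memLp_pathIntegral (measurable_uncurry_started hX) hgr (hψ.hasFirstMoment_atom t k)
  simp only [rhoW, hψ.waveletTransform_eq]
  fin_cases p
  · simpa [rho] using h
  · simpa [rho] using h.norm.ofReal (K := ℂ)

/-- The modulus is nonlinear, so uncorrelated coefficients would not suffice; independence factors
the expectation of any product of measurable functions of them. -/
theorem covMatrix_rhoW_eq_zero (hX : Measurable (Function.uncurry X))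
    (hstat : HasStationaryIncrements X P) (hG : IsGaussianProcess X P)
    (hψ : IsWavelet ψ) (hpos : PositiveFrequencies ψ) {j k : ℤ}
    (hdisj : ∀ ω : ℝ, hat (dilate ψ j) ω * hat (dilate ψ k) ω = 0) (t s : ℝ) :
    covMatrix P (rhoW ψ X t j) (rhoW ψ X s k) = 0 := by
  have hm : ∀ u, MemLp (X u) 2 P := fun u => (hG.hasGaussianLaw_eval u).memLp_two
  obtain ⟨C, hC, hgr, -⟩ := exists_growth_variogram hX hstat hm
  have hae : ∀ t k, AEMeasurable (pathIntegral (started X) (atom ψ t k)) P := fun t k =>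
    (memLp_pathIntegral (measurable_uncurry_started hX) hgr
      (hψ.hasFirstMoment_atom t k)).aestronglyMeasurable.aemeasurable
  ext p q
  simp only [covMatrix, Matrix.of_apply, Matrix.zero_apply, rhoW, hψ.waveletTransform_eq]
  rw [(indepFun_pathIntegral_atom hX hstat hG hψ hpos hdisj t s).integral_fun_comp_mul_comp
    (f := fun z => rho z p) (g := fun z => conj (rho z q)) (hae t j) (hae s k)
    (measurable_rho p).aestronglyMeasurable
    (Complex.continuous_conj.measurable.comp (measurable_rho q)).aestronglyMeasurable,
    integral_conj, sub_self]

end Gaussian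

end WaveletCov

theorem mainTheorem4 {Ω : Type*} [MeasurableSpace Ω] (P : Measure Ω) [IsProbabilityMeasure P]
    (X : ℝ → Ω → ℝ) (hX : Measurable (Function.uncurry X))
    (hstat : WaveletCov.HasStationaryIncrements X P)
    (ψ : ℝ → ℂ) (hψ : WaveletCov.IsWavelet ψ) (hpos : WaveletCov.PositiveFrequencies ψ)
    (j a : ℤ)
    (hdisj : ∀ ω : ℝ, WaveletCov.hat (WaveletCov.dilate ψ j) ω * WaveletCov.hat (WaveletCov.dilate ψ (j - a)) ω = 0) :
    (IsGaussianProcess X P →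
      -- the wavelet coefficients are almost surely convergent integrals with finite second moment
      (∀ (t : ℝ) (k : ℤ),
        (∀ᵐ ω ∂P, Integrable (fun u : ℝ => (X u ω : ℂ) * WaveletCov.dilate ψ k (t - u))) ∧
        (∀ p : Fin 2, MemLp (fun ω => WaveletCov.rhoW ψ X t k ω p) 2 P)) ∧
      (∀ t τ : ℝ,
        WaveletCov.covMatrix P (WaveletCov.rhoW ψ X t j)
          (WaveletCov.rhoW ψ X (t - (2 : ℝ) ^ j * τ) (j - a)) = 0)) ∧
    ((∃ (t τ : ℝ) (p q : Fin 2),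
        WaveletCov.covMatrix P (WaveletCov.rhoW ψ X t j)
          (WaveletCov.rhoW ψ X (t - (2 : ℝ) ^ j * τ) (j - a)) p q ≠ 0) →
      ¬ IsGaussianProcess X P) := by
  have hcov : IsGaussianProcess X P → ∀ t τ : ℝ,
      WaveletCov.covMatrix P (WaveletCov.rhoW ψ X t j)
        (WaveletCov.rhoW ψ X (t - (2 : ℝ) ^ j * τ) (j - a)) = 0 := fun hG t τ =>
    WaveletCov.covMatrix_rhoW_eq_zero hX hstat hG hψ hpos hdisj t _
  refine ⟨fun hG => ⟨fun t k => ⟨WaveletCov.ae_integrable_waveletTransform hX hstat hG hψ t k,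
    WaveletCov.memLp_rhoW hX hstat hG hψ t k⟩, hcov hG⟩, ?_⟩
  rintro ⟨t, τ, p, q, hne⟩ hG
  exact hne (by rw [hcov hG t τ, Matrix.zero_apply])
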